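/- Let $R$ be a commutative coherent ring (every finitely generated ideal of $R$ is finitely presented). Let $\text{mod-}R$ be the abelian category of finitely presented $R$-modules, and let $\mathrm{Sp}(\text{mod-}R)$ be the set of $\cap$-irreducible Serre subcategories of $\text{mod-}R$, that is, of those Serre subcategories $\mathcal{S} \neq \text{mod-}R$ such that, whenever $\mathcal{S} = \mathcal{S}_1 \cap \mathcal{S}_2$ with $\mathcal{S}_1, \mathcal{S}_2$ Serre subcategories of $\text{mod-}R$, one has $\mathcal{S} = \mathcal{S}_1$ or $\mathcal{S} = \mathcal{S}_2$. For a prime ideal $P$ of $R$ let $E(R/P)$ denote the injective hull of the $R$-module $R/P$. Then $$P \longmapsto \{A \in \text{mod-}R : \mathrm{Hom}_R(A, E(R/P)) = 0\}$$ is a (well-defined) bijection from the set $\mathrm{Spec}(R)$ of prime ideals of $R$ to $\mathrm{Sp}(\text{mod-}R)$. -/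

import Mathlib

universe v u

open CategoryTheory Limits

/-- A commutative ring is *coherent* if each of its finitely generated ideals is finitely
presented as a module. -/
class IsCoherentCommRing (R : Type u) [CommRing R] : Prop where
  finitePresentation_of_fg : ∀ I : Ideal R, I.FG → Module.FinitePresentation R I

namespace IsCoherentCommRing

/-- Every finitely generated module that embeds in `M` is finitely presented. -/
def FGSubmodulesFP (R : Type u) [CommRing R] (M : Type u) [AddCommGroup M] [Module R M] : Prop :=
  ∀ (N : Type u) [AddCommGroup N] [Module R N] (f : N →ₗ[R] M),
    Function.Injective f → Module.Finite R N → Module.FinitePresentation R N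

variable {R : Type u} [CommRing R]

lemma fgSubmodulesFP_self [IsCoherentCommRing R] : FGSubmodulesFP R R := by
  intro N _ _ f hf hN
  have := finitePresentation_of_fg (R := R) (LinearMap.range f) (Submodule.fg_range f)
  exact .of_equiv (LinearEquiv.ofInjective f hf).symm

lemma fgSubmodulesFP_prod {M M' : Type u} [AddCommGroup M] [Module R M] [AddCommGroup M']
    [Module R M'] (h : FGSubmodulesFP R M) (h' : FGSubmodulesFP R M') :
    FGSubmodulesFP R (M × M') := by
  intro N _ _ f hf hN
  let g : N →ₗ[R] M := LinearMap.fst R M M' ∘ₗ f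
  have h1 : Module.FinitePresentation R (LinearMap.range g) :=
    h _ (LinearMap.range g).subtype (Submodule.injective_subtype _) inferInstance
  have h2 : (LinearMap.ker g.rangeRestrict).FG :=
    Module.FinitePresentation.fg_ker _ g.surjective_rangeRestrict
  have h3 : Module.FinitePresentation R (LinearMap.ker g.rangeRestrict) := by
    refine h' _ (LinearMap.snd R M M' ∘ₗ f ∘ₗ (LinearMap.ker g.rangeRestrict).subtype) ?_
      (Module.Finite.iff_fg.mpr h2)
    rw [← LinearMap.ker_eq_bot, LinearMap.ker_eq_bot']
    rintro ⟨x, hx⟩ hx'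
    have hx1 : (f x).1 = 0 := by
      have := congrArg Subtype.val (LinearMap.mem_ker.mp hx)
      exact this
    have : f x = 0 := Prod.ext hx1 hx'
    exact Subtype.ext (hf (by simpa using this))
  exact Module.finitePresentation_of_ker _ g.surjective_rangeRestrict

lemma fgSubmodulesFP_of_equiv {M M' : Type u} [AddCommGroup M] [Module R M] [AddCommGroup M']
    [Module R M'] (e : M ≃ₗ[R] M') (h : FGSubmodulesFP R M) : FGSubmodulesFP R M' := by
  intro N _ _ f hf hN
  exact h N (e.symm.toLinearMap ∘ₗ f) (e.symm.injective.comp hf) hN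

lemma fgSubmodulesFP_pi [IsCoherentCommRing R] (n : ℕ) : FGSubmodulesFP R (Fin n → R) := by
  induction n with
  | zero =>
    intro N _ _ f hf _
    have : Subsingleton N := hf.subsingleton
    infer_instance
  | succ n ih =>
    exact fgSubmodulesFP_of_equiv (Fin.consLinearEquiv R (fun _ : Fin (n + 1) => R))
      (fgSubmodulesFP_prod fgSubmodulesFP_self ih)

/-- Over a coherent ring, finitely generated submodules of finitely presented modules are finitely
presented. -/
lemma fgSubmodulesFP_of_finitePresentation [IsCoherentCommRing R] (M : Type u) [AddCommGroup M]
    [Module R M] [Module.FinitePresentation R M] : FGSubmodulesFP R M := by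
  intro N _ _ f hf hN
  obtain ⟨n, g, hg⟩ := Module.Finite.exists_fin' R M
  have hK : (LinearMap.ker g).FG := Module.FinitePresentation.fg_ker g hg
  let L : Submodule R (Fin n → R) := (LinearMap.range f).comap g
  have hL : L.FG := by
    refine Submodule.fg_of_fg_map_of_fg_inf_ker g ?_ ?_
    · rw [Submodule.map_comap_eq_of_surjective hg]
      exact Submodule.fg_range f
    · rwa [inf_eq_right.mpr]
      intro x hx
      simp [L, LinearMap.mem_ker.mp hx]
  have : Module.FinitePresentation R L :=
    fgSubmodulesFP_pi n L L.subtype L.injective_subtype (Module.Finite.iff_fg.mpr hL)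
  let q : L →ₗ[R] LinearMap.range f := g.restrict (fun _ hx => hx)
  have hq : Function.Surjective q := by
    rintro ⟨y, hy⟩
    obtain ⟨x, rfl⟩ := hg y
    exact ⟨⟨x, hy⟩, rfl⟩
  have hqk : (LinearMap.ker q).FG := by
    have h1 : (LinearMap.ker q).map L.subtype = LinearMap.ker g := by
      ext x
      simp only [Submodule.mem_map, LinearMap.mem_ker, Subtype.exists]
      constructor
      · rintro ⟨a, ha, h, rfl⟩
        exact congrArg Subtype.val h
      · intro hx
        exact ⟨x, by simp [L, hx], Subtype.ext hx, rfl⟩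
    exact Submodule.fg_of_fg_map_injective L.subtype L.injective_subtype (h1 ▸ hK)
  have := Module.finitePresentation_of_surjective q hq hqk
  exact .of_equiv (LinearEquiv.ofInjective f hf).symm

end IsCoherentCommRing

/-- The property of being a finitely presented `R`-module. -/
def ModuleCat.isFP (R : Type u) [CommRing R] : ObjectProperty (ModuleCat.{u} R) :=
  fun M => Module.FinitePresentation R M

namespace ModuleCat

variable (R : Type u) [CommRing R]

instance : (isFP R).ContainsZero where
  exists_zero := ⟨ModuleCat.of R PUnit, ModuleCat.isZero_of_subsingleton _,
    (inferInstance : Module.FinitePresentation R PUnit.{u + 1})⟩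

instance : (isFP R).IsClosedUnderIsomorphisms where
  of_iso {M N} e h :=
    have : Module.FinitePresentation R M := h
    (Module.FinitePresentation.of_equiv e.toLinearEquiv : Module.FinitePresentation R N)

instance : (isFP R).IsClosedUnderFiniteProducts where
  isClosedUnderLimitsOfShape J _ := by
    refine ⟨?_⟩
    rintro X ⟨p⟩
    let Z : J → ModuleCat.{u} R := fun j => p.diag.obj ⟨j⟩
    have hZ : ∀ j, Module.FinitePresentation R (Z j) := fun j => p.prop_diag_obj ⟨j⟩
    let i : p.diag ≅ Discrete.functor Z := Discrete.natIso (fun _ => Iso.refl _)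
    let e : X ≅ ∏ᶜ Z := (IsLimit.conePointsIsoOfNatIso p.isLimit (limit.isLimit _) i)
    exact (isFP R).prop_of_iso (e ≪≫ ModuleCat.piIsoPi Z).symm
      (inferInstance : Module.FinitePresentation R (∀ j, Z j))

instance : (isFP R).IsClosedUnderCokernels where
  cokernels_le := by
    rintro _ ⟨f, k, hk, hX, hY⟩
    rename_i X Y
    have : Module.FinitePresentation R X := hX
    have : Module.FinitePresentation R Y := hY
    have e := IsColimit.coconePointUniqueUpToIso hk (ModuleCat.cokernelIsColimit f)
    have h : Module.FinitePresentation R (Y ⧸ LinearMap.range f.hom) := by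
      refine Module.finitePresentation_of_surjective (LinearMap.range f.hom).mkQ
        (Submodule.mkQ_surjective _) ?_
      rw [Submodule.ker_mkQ]
      exact Submodule.fg_range _
    exact (isFP R).prop_of_iso e.symm h

instance [IsCoherentCommRing R] : (isFP R).IsClosedUnderKernels where
  kernels_le := by
    rintro _ ⟨f, k, hk, hX, hY⟩
    rename_i X Y
    have : Module.FinitePresentation R X := hX
    have : Module.FinitePresentation R Y := hY
    have e := IsLimit.conePointUniqueUpToIso hk (ModuleCat.kernelIsLimit f)
    refine (isFP R).prop_of_iso e.symm ?_
    have h1 : Module.FinitePresentation R (LinearMap.range f.hom) :=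
      IsCoherentCommRing.fgSubmodulesFP_of_finitePresentation Y _ (LinearMap.range f.hom).subtype
        (Submodule.injective_subtype _) inferInstance
    have h2 : (LinearMap.ker f.hom).FG := by
      rw [← LinearMap.ker_rangeRestrict]
      exact Module.FinitePresentation.fg_ker _ f.hom.surjective_rangeRestrict
    exact IsCoherentCommRing.fgSubmodulesFP_of_finitePresentation X _ (LinearMap.ker f.hom).subtype
        (Submodule.injective_subtype _) (Module.Finite.iff_fg.mpr h2)

end ModuleCat

/-- The category `mod-R` of finitely presented `R`-modules. If `R` is coherent then it is an abelian
category, with kernels and cokernels computed as for `R`-modules: the instance is the one for full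
subcategories closed under kernels, cokernels and finite products. -/
abbrev FPModuleCat (R : Type u) [CommRing R] : Type (u + 1) := (ModuleCat.isFP R).FullSubcategory

section Serre

variable (A : Type u) [Category.{v} A] [Abelian A]

/-- The type `Ser(A)` of Serre subcategories of an abelian category, ordered by inclusion. -/
abbrev SerreSubcategory : Type u := {S : ObjectProperty A // S.IsSerreClass}

variable {A} in
/-- The intersection of two Serre subcategories is a Serre subcategory. -/
lemma isSerreClass_inf {S T : ObjectProperty A} (hS : S.IsSerreClass) (hT : T.IsSerreClass) :
    (S ⊓ T).IsSerreClass where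
  exists_zero :=
    have ⟨Z, hZ⟩ := HasZeroObject.zero (C := A)
    ⟨Z, hZ, S.prop_of_isZero hZ, T.prop_of_isZero hZ⟩
  prop_of_mono f _ h := ⟨S.prop_of_mono f h.1, T.prop_of_mono f h.2⟩
  prop_of_epi f _ h := ⟨S.prop_of_epi f h.1, T.prop_of_epi f h.2⟩
  prop_X₂_of_shortExact h h₁ h₃ :=
    ⟨S.prop_X₂_of_shortExact h h₁.1 h₃.1, T.prop_X₂_of_shortExact h h₁.2 h₃.2⟩

/-- The meet of two Serre subcategories is their intersection. -/
noncomputable instance : SemilatticeInf (SerreSubcategory A) :=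
  Subtype.semilatticeInf fun _ _ hS hT => isSerreClass_inf hS hT

/-- `Sp(A)`: the set of `∩`-irreducible Serre subcategories of `A`, i.e. those `S` which are proper
(not the largest element `A` of `Ser(A)`) and such that `S = S₁ ∩ S₂` with `S₁`, `S₂` Serre
subcategories implies `S = S₁` or `S = S₂`. -/
def irreducibleSerre : Set (SerreSubcategory A) := {S | InfIrred S}

end Serre

/-- `ι : M → E` exhibits `E` as an injective hull of `M`: the module `E` is injective and `ι` is an
essential embedding. -/
structure IsInjectiveHull {R M E : Type u} [CommRing R] [AddCommGroup M] [Module R M]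
    [AddCommGroup E] [Module R E] (ι : M →ₗ[R] E) : Prop where
  module_injective : Module.Injective R E
  injective : Function.Injective ι
  essential : ∀ N : Submodule R E, N ⊓ LinearMap.range ι = ⊥ → N = ⊥

/-!
A module `A` in `mod-R` has no nonzero map to `E(R/P)` if and only if `P` is not in the support of
`A`, that is, if and only if some ideal not contained in `P` annihilates `A`
(`IsInjectiveHull.forall_hom_eq_zero_iff`). Indeed an element outside `P` acts injectively on
`E(R/P)` because it does on the essential submodule `R/P`; conversely, if the annihilator of some
element `x` lies in `P`, then `Rx → R/P → E(R/P)` extends to `A` by injectivity. Injective hulls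
exist as maximal essential extensions inside an injective module.

A Serre subcategory `S` of `mod-R` is determined by the ideals `I` with `R/I ∈ S`, which are closed
under products: `A ∈ S` if and only if such an ideal annihilates `A` (`SerreSubcategory.mem_iff`).
Coherence enters here, since finitely generated submodules, in particular the cyclic ones, are
subobjects in `mod-R`. Conversely, every multiplicatively closed set of ideals defines a Serre
subcategory (`SerreSubcategory.annihilatedBy`); the ideals not contained in `P` define the one of
the theorem.

The subcategory of `P` is irreducible: if `S` and `T` contain it strictly, they contain `R/I` and
`R/J` with `I, J ⊆ P`, so `S ∩ T` contains `R/(I + J)`, whose support contains `P`. Conversely, let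
`S` be irreducible. If `R/(I + J) ∈ S`, then `S` is the intersection of the Serre subcategories
generated by `S` with `R/I` and by `S` with `R/J`, so `R/I ∈ S` or `R/J ∈ S`
(`SerreSubcategory.mem_or_mem_of_sup_mem_ideals`). Hence the `r` with `R/(r) ∉ S` form a prime ideal
`P`, every `I` with `R/I ∈ S` contains some `r` with `R/(r) ∈ S`, and `S` is the subcategory of `P`.
-/

/-! ### Injective hulls -/

namespace IsInjectiveHull

variable {R : Type u} [CommRing R]

/-- A submodule `E` of an injective module `Q` that is maximal among the essential extensions of `M`
in `Q` is a direct summand, hence injective. If `C` is maximal among the submodules disjoint from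
`E`, then `Q ⧸ C` is an essential extension of the image of `E`. So the inclusion of `E` in `Q`
extends to an embedding of `Q ⧸ C` in `Q`, whose image is `E` by maximality. -/
lemma module_injective_of_maximal {Q : Type u} [AddCommGroup Q] [Module R Q]
    [Module.Injective R Q] {M E : Submodule R Q}
    (hE : Maximal (fun E : Submodule R Q ↦
      M ≤ E ∧ ∀ x ∈ E, x ≠ 0 → ∃ r : R, r • x ≠ 0 ∧ r • x ∈ M) E) :
    Module.Injective R E := by
  obtain ⟨C, -, hC⟩ := zorn_le_nonempty₀ {C : Submodule R Q | Disjoint C E} (by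
    intro c hc hchain C₀ hC₀
    refine ⟨sSup c, ?_, fun _ ↦ le_sSup⟩
    refine Submodule.disjoint_def.2 fun x hx hxE ↦ ?_
    obtain ⟨C, hCc, hxC⟩ := (Submodule.mem_sSup_of_directed ⟨C₀, hC₀⟩ hchain.directedOn).1 hx
    exact Submodule.disjoint_def.1 (hc hCc) x hxC hxE) ⊥ (by simp)
  have hCE : ∀ x ∈ C, x ∈ E → x = 0 := Submodule.disjoint_def.1 hC.prop
  have hinj : Function.Injective (C.mkQ ∘ₗ E.subtype) := by
    rw [injective_iff_map_eq_zero]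
    rintro ⟨e, he⟩ h
    exact Subtype.ext (hCE e (by simpa using h) he)
  have hess : ∀ y : Q ⧸ C, y ≠ 0 → ∃ r : R, ∃ e : E, e ≠ 0 ∧ r • y = C.mkQ e := by
    intro y hy
    obtain ⟨x, rfl⟩ := C.mkQ_surjective y
    have hx : x ∉ C := by simpa using hy
    by_contra! hcon
    have hdisj : Disjoint (C ⊔ Submodule.span R {x}) E := by
      rw [Submodule.disjoint_def]
      intro e he heE
      obtain ⟨c, hc, z, hz, rfl⟩ := Submodule.mem_sup.1 he
      obtain ⟨r, rfl⟩ := Submodule.mem_span_singleton.1 hz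
      by_contra hne
      refine hcon r ⟨_, heE⟩ (fun h ↦ hne (congrArg Subtype.val h)) ?_
      have hc0 : C.mkQ c = 0 := by simpa using hc
      simp only [map_add, hc0, zero_add, map_smul]
    exact hx (hC.le_of_ge hdisj le_sup_left
      (Submodule.mem_sup_right (Submodule.mem_span_singleton_self x)))
  obtain ⟨φ, hφ⟩ := Module.Injective.out (C.mkQ ∘ₗ E.subtype) hinj E.subtype
  replace hφ : ∀ e : E, φ (C.mkQ e) = e := hφ
  have hrange : LinearMap.range φ ≤ E := by
    refine hE.le_of_ge ⟨?_, ?_⟩ ?_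
    · exact fun m hm ↦ ⟨_, hφ ⟨m, hE.prop.1 hm⟩⟩
    · rintro _ ⟨y, rfl⟩ hy
      obtain ⟨r, e, he, hr⟩ := hess y (by rintro rfl; simp at hy)
      obtain ⟨s, hs, hsM⟩ := hE.prop.2 e e.2 (by simpa using he)
      have key : (s * r) • φ y = s • (e : Q) := by
        rw [mul_smul, ← map_smul, hr, hφ]
      exact ⟨s * r, by rwa [key], by rwa [key]⟩
    · exact fun e he ↦ ⟨_, hφ ⟨e, he⟩⟩
  refine ⟨fun X Y _ _ _ _ f hf g ↦ ?_⟩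
  obtain ⟨h, hh⟩ := Module.Injective.out f hf (E.subtype ∘ₗ g)
  refine ⟨(φ ∘ₗ C.mkQ ∘ₗ h).codRestrict E fun y ↦ hrange ⟨_, rfl⟩, fun x ↦ Subtype.ext ?_⟩
  have hx : h (f x) = g x := hh x
  simp only [LinearMap.codRestrict_apply, LinearMap.comp_apply, hx, hφ]

theorem exists_isInjectiveHull (M : Type u) [AddCommGroup M] [Module R M] :
    ∃ (E : ModuleCat.{u} R) (ι : M →ₗ[R] E), IsInjectiveHull ι := by
  let Q := Injective.under (ModuleCat.of R M)
  let i : M →ₗ[R] Q := (Injective.ι (ModuleCat.of R M)).hom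
  have hi : Function.Injective i :=
    (ModuleCat.mono_iff_injective (Injective.ι (ModuleCat.of R M))).1 inferInstance
  have hQ' : Injective (ModuleCat.of R Q) := Injective.injective_under (ModuleCat.of R M)
  have hQ : Module.Injective R Q := Module.injective_module_of_injective_object R Q
  obtain ⟨E, hiE, hE⟩ := zorn_le_nonempty₀ {E : Submodule R Q | LinearMap.range i ≤ E ∧
      ∀ x ∈ E, x ≠ 0 → ∃ r : R, r • x ≠ 0 ∧ r • x ∈ LinearMap.range i} (by
    intro c hc hchain E₀ hE₀
    refine ⟨sSup c, ⟨(hc hE₀).1.trans (le_sSup hE₀), fun x hx ↦ ?_⟩, fun _ ↦ le_sSup⟩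
    obtain ⟨E, hEc, hxE⟩ := (Submodule.mem_sSup_of_directed ⟨E₀, hE₀⟩ hchain.directedOn).1 hx
    exact (hc hEc).2 x hxE) (LinearMap.range i) ⟨le_rfl, fun x hx h ↦ ⟨1, by simpa, by simpa⟩⟩
  refine ⟨ModuleCat.of R E, i.codRestrict E fun m ↦ hiE ⟨m, rfl⟩,
    module_injective_of_maximal hE, fun x y h ↦ hi (congrArg Subtype.val h), fun N hN ↦ ?_⟩
  rw [Submodule.eq_bot_iff]
  intro x hx
  by_contra hne
  obtain ⟨r, hr, m, hm⟩ := hE.prop.2 x.1 x.2 (fun h ↦ hne (Subtype.ext h))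
  have hmem : r • x ∈ N ⊓ LinearMap.range (i.codRestrict E fun m ↦ hiE ⟨m, rfl⟩) :=
    ⟨N.smul_mem r hx, m, Subtype.ext hm⟩
  rw [hN, Submodule.mem_bot] at hmem
  exact hr (congrArg Subtype.val hmem)

/-- A finitely generated module `A` has no nonzero map to the injective hull of `R ⧸ P` if and only
if it is annihilated by some ideal not contained in `P`, that is, if and only if `P` is not in the
support of `A`. -/
theorem forall_hom_eq_zero_iff {P : Ideal R} [P.IsPrime] {E : Type u} [AddCommGroup E]
    [Module R E] {ι : (R ⧸ P) →ₗ[R] E} (hι : IsInjectiveHull ι) (A : Type u) [AddCommGroup A]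
    [Module R A] [Module.Finite R A] :
    (∃ I : Ideal R, ¬ I ≤ P ∧ I ≤ Module.annihilator R A) ↔ ∀ f : A →ₗ[R] E, f = 0 := by
  constructor
  · rintro ⟨I, hIP, hIA⟩ f
    obtain ⟨s, hsI, hsP⟩ := Set.not_subset.1 hIP
    -- The elements killed by `s` form a submodule meeting `R ⧸ P` in zero.
    have hs : Submodule.torsionBy R E s = ⊥ := by
      refine hι.essential _ ?_
      rw [Submodule.eq_bot_iff]
      rintro _ ⟨hx, y, rfl⟩
      obtain ⟨r, rfl⟩ := Ideal.Quotient.mk_surjective y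
      have h : ι (Ideal.Quotient.mk P (s * r)) = ι 0 := by
        rw [map_zero]
        have := (Submodule.mem_torsionBy_iff s _).1 hx
        rw [← map_smul] at this
        exact this
      have hr := (Ideal.IsPrime.mem_or_mem ‹_›
        (Ideal.Quotient.eq_zero_iff_mem.1 (hι.injective h))).resolve_left hsP
      rw [Ideal.Quotient.eq_zero_iff_mem.2 hr, map_zero]
    ext a
    have : f a ∈ Submodule.torsionBy R E s := by
      rw [Submodule.mem_torsionBy_iff, ← map_smul, Module.mem_annihilator.1 (hIA hsI) a, map_zero]
    simpa [hs] using this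
  · intro h
    -- A cyclic submodule whose annihilator lies in `P` maps onto `R ⧸ P`.
    have hcyc : ∀ x : A, ¬ Ideal.torsionOf R A x ≤ P := by
      intro x hx
      let e := Ideal.quotTorsionOfEquivSpanSingleton R A x
      let q : (R ⧸ Ideal.torsionOf R A x) →ₗ[R] (R ⧸ P) := Submodule.factor hx
      obtain ⟨g, hg⟩ := hι.module_injective.out (Submodule.span R {x}).subtype
        (Submodule.injective_subtype _) (ι ∘ₗ q ∘ₗ e.symm.toLinearMap)
      have h1 := hg (e (Ideal.Quotient.mk _ 1))
      rw [h g] at h1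
      have h2 : ι (Ideal.Quotient.mk P 1) = ι 0 := by
        rw [map_zero]
        have h3 : e.symm (e (Ideal.Quotient.mk _ 1)) = Ideal.Quotient.mk _ 1 :=
          e.symm_apply_apply _
        rw [LinearMap.comp_apply, LinearMap.comp_apply, LinearEquiv.coe_coe, h3] at h1
        exact h1.symm
      exact Ideal.IsPrime.ne_top ‹_› ((Ideal.eq_top_iff_one P).2
        (Ideal.Quotient.eq_zero_iff_mem.1 (hι.injective h2)))
    have hsub : ∀ N : Submodule R A, N.FG → ∃ I : Ideal R, ¬ I ≤ P ∧ I ≤ N.annihilator := by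
      intro N hN
      induction N, hN using Submodule.fg_induction with
      | singleton x =>
        refine ⟨_, hcyc x, fun r hr ↦ ?_⟩
        rw [Submodule.mem_annihilator_span_singleton]
        exact hr
      | sup N₁ N₂ _ _ h₁ h₂ =>
        obtain ⟨I, hI, hI'⟩ := h₁
        obtain ⟨J, hJ, hJ'⟩ := h₂
        refine ⟨I * J, fun hIJ ↦ ((Ideal.IsPrime.mul_le ‹_›).1 hIJ).elim hI hJ, ?_⟩
        rw [Submodule.annihilator_sup]
        exact Ideal.mul_le_inf.trans (inf_le_inf hI' hJ')
    obtain ⟨I, hI, hI'⟩ := hsub ⊤ Module.Finite.fg_top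
    exact ⟨I, hI, by rwa [Submodule.annihilator_top] at hI'⟩

end IsInjectiveHull

/-! ### Exactness in the category of finitely presented modules -/

namespace FPModuleCat

variable {R : Type u} [CommRing R]

instance (A : FPModuleCat R) : Module.FinitePresentation R A.obj := A.property

/-- A finitely presented module as an object of `mod-R`. -/
abbrev of (R : Type u) [CommRing R] (M : Type u) [AddCommGroup M] [Module R M]
    [h : Module.FinitePresentation R M] : FPModuleCat R :=
  ⟨ModuleCat.of R M, h⟩

/-- A linear map between finitely presented modules as a morphism of `mod-R`. -/
abbrev ofHom {A B : FPModuleCat R} (f : A.obj →ₗ[R] B.obj) : A ⟶ B :=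
  ObjectProperty.homMk (ModuleCat.ofHom f)

lemma mono_ofHom {A B : FPModuleCat R} (f : A.obj →ₗ[R] B.obj) (hf : Function.Injective f) :
    Mono (ofHom f) :=
  (ModuleCat.isFP R).ι.mono_of_mono_map ((ModuleCat.mono_iff_injective (ModuleCat.ofHom f)).2 hf)

lemma epi_ofHom {A B : FPModuleCat R} (f : A.obj →ₗ[R] B.obj) (hf : Function.Surjective f) :
    Epi (ofHom f) :=
  (ModuleCat.isFP R).ι.epi_of_epi_map ((ModuleCat.epi_iff_surjective (ModuleCat.ofHom f)).2 hf)

lemma injective_of_mono {A B : FPModuleCat R} (f : A ⟶ B) [Mono f] :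
    Function.Injective f.hom.hom := by
  intro x y h
  have : ofHom (A := of R R) (LinearMap.toSpanSingleton R A.obj x) =
      ofHom (A := of R R) (LinearMap.toSpanSingleton R A.obj y) := by
    rw [← cancel_mono f]
    ext
    simpa using h
  have h1 := congrArg (fun g ↦ g.hom.hom (1 : R)) this
  simpa using h1

lemma surjective_of_epi {A B : FPModuleCat R} (f : A ⟶ B) [Epi f] :
    Function.Surjective f.hom.hom := by
  have hfp : Module.FinitePresentation R (B.obj ⧸ LinearMap.range f.hom.hom) :=
    Module.finitePresentation_of_surjective (LinearMap.range f.hom.hom).mkQ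
      (Submodule.mkQ_surjective _) (by rw [Submodule.ker_mkQ]; exact Submodule.fg_range _)
  have : ofHom (B := of R (B.obj ⧸ LinearMap.range f.hom.hom)) (LinearMap.range f.hom.hom).mkQ =
      ofHom (B := of R (B.obj ⧸ LinearMap.range f.hom.hom)) 0 := by
    rw [← cancel_epi f]
    ext x
    simp
  rw [← LinearMap.range_eq_top, ← Submodule.ker_mkQ (LinearMap.range f.hom.hom),
    LinearMap.ker_eq_top]
  exact congrArg (fun g ↦ g.hom.hom) this

variable [IsCoherentCommRing R]

lemma exact_of_shortExact {S : ShortComplex (FPModuleCat R)} (hS : S.ShortExact) {x : S.X₂.obj}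
    (hx : S.g.hom.hom x = 0) : ∃ y, S.f.hom.hom y = x := by
  have := hS.mono_f
  obtain ⟨l, hl⟩ := hS.exact.lift' (A := of R R)
    (ofHom (A := of R R) (LinearMap.toSpanSingleton R S.X₂.obj x)) (by ext; simpa using hx)
  refine ⟨l.hom.hom (1 : R), ?_⟩
  have h1 := congrArg (fun g ↦ g.hom.hom (1 : R)) hl
  simpa using h1

lemma shortExact_ofHom {A B C : FPModuleCat R} (f : A.obj →ₗ[R] B.obj) (g : B.obj →ₗ[R] C.obj)
    (hf : Function.Injective f) (hg : Function.Surjective g) (hfg : Function.Exact f g) :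
    ∃ w, (ShortComplex.mk (ofHom f) (ofHom g) w).ShortExact := by
  have w : ofHom f ≫ ofHom g = 0 := by
    ext x
    exact hfg.apply_apply_eq_zero x
  have hmono := mono_ofHom f hf
  have hepi := epi_ofHom g hg
  refine ⟨w, { exact := ?_ }⟩
  apply ShortComplex.exact_of_f_is_kernel
  have hk : ∀ {Z : FPModuleCat R} (k : Z ⟶ B) (_ : k ≫ ofHom g = 0) (z : Z.obj),
      k.hom.hom z ∈ LinearMap.range f := fun k hk z ↦
    (hfg _).1 (congrArg (fun h ↦ h.hom.hom z) hk)
  refine KernelFork.IsLimit.ofι' _ _ fun {Z} k hk' ↦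
    ⟨ofHom ((LinearEquiv.ofInjective f hf).symm.toLinearMap ∘ₗ
      k.hom.hom.codRestrict _ (hk k hk')), ?_⟩
  ext z
  exact congrArg Subtype.val ((LinearEquiv.ofInjective f hf).apply_symm_apply
    ⟨k.hom.hom z, hk k hk' z⟩)

end FPModuleCat

/-! ### Serre subcategories and annihilating ideals -/

lemma Ideal.FG.finitePresentation_quotient {R : Type u} [CommRing R] {I : Ideal R} (hI : I.FG) :
    Module.FinitePresentation R (R ⧸ I) :=
  Module.finitePresentation_of_surjective I.mkQ I.mkQ_surjective (by rwa [Submodule.ker_mkQ])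

namespace SerreSubcategory

open FPModuleCat

variable {R : Type u} [CommRing R] [IsCoherentCommRing R]

/-- The unbundled form of membership in a Serre subcategory of `mod-R`: the module `M` is finitely
presented and, as an object of `mod-R`, belongs to `S`. -/
def Mem (S : SerreSubcategory (FPModuleCat R)) (M : Type u) [AddCommGroup M] [Module R M] : Prop :=
  ∃ _ : Module.FinitePresentation R M, S.1 (of R M)

variable {S : SerreSubcategory (FPModuleCat R)} {L M N : Type u} [AddCommGroup L] [Module R L]
  [AddCommGroup M] [Module R M] [AddCommGroup N] [Module R N]

lemma mem_obj_iff {A : FPModuleCat R} : Mem S A.obj ↔ S.1 A :=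
  ⟨fun ⟨_, h⟩ ↦ h, fun h ↦ ⟨A.property, h⟩⟩

lemma Mem.of_injective [hN : Module.Finite R N] (hM : Mem S M) (f : N →ₗ[R] M)
    (hf : Function.Injective f) : Mem S N := by
  obtain ⟨_, h⟩ := hM
  have := S.2
  have hfp := IsCoherentCommRing.fgSubmodulesFP_of_finitePresentation M N f hf hN
  have := mono_ofHom (A := of R N) (B := of R M) f hf
  exact ⟨hfp, S.1.prop_of_mono (ofHom (A := of R N) (B := of R M) f) h⟩

lemma Mem.of_surjective [hN : Module.FinitePresentation R N] (hM : Mem S M) (f : M →ₗ[R] N)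
    (hf : Function.Surjective f) : Mem S N := by
  obtain ⟨_, h⟩ := hM
  have := S.2
  have := epi_ofHom (A := of R M) (B := of R N) f hf
  exact ⟨hN, S.1.prop_of_epi (ofHom (A := of R M) (B := of R N) f) h⟩

lemma Mem.of_exact [hM : Module.FinitePresentation R M] (hL : Mem S L) (hN : Mem S N)
    (f : L →ₗ[R] M) (g : M →ₗ[R] N) (hf : Function.Injective f) (hg : Function.Surjective g)
    (hfg : Function.Exact f g) : Mem S M := by
  obtain ⟨_, hL⟩ := hL
  obtain ⟨_, hN⟩ := hN
  have := S.2
  obtain ⟨w, hw⟩ := shortExact_ofHom (A := of R L) (B := of R M) (C := of R N) f g hf hg hfg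
  exact ⟨hM, S.1.prop_X₂_of_shortExact hw hL hN⟩

lemma Mem.prod (hM : Mem S M) (hN : Mem S N) : Mem S (M × N) := by
  have := hM.1
  have := hN.1
  exact hM.of_exact hN (LinearMap.inl R M N) (LinearMap.snd R M N) LinearMap.inl_injective
    LinearMap.snd_surjective .inl_snd

/-- A finitely presented module annihilated by `I` is built from quotients of `R ⧸ I` by finitely
many extensions and quotients. -/
lemma Mem.of_le_annihilator [Module.FinitePresentation R M] {I : Ideal R} (hI : Mem S (R ⧸ I))
    (h : I ≤ Module.annihilator R M) : Mem S M := by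
  have hfp : ∀ K : Submodule R M, K.FG → Module.FinitePresentation R K := fun K hK ↦
    IsCoherentCommRing.fgSubmodulesFP_of_finitePresentation M K K.subtype
      K.injective_subtype (Module.Finite.iff_fg.2 hK)
  have key : ∀ K : Submodule R M, K.FG → Mem S K := by
    intro K hK
    induction K, hK using Submodule.fg_induction with
    | singleton x =>
      have := hfp (Submodule.span R {x}) (Submodule.fg_span_singleton x)
      have hle : I ≤ Ideal.torsionOf R M x := fun r hr ↦
        (Ideal.mem_torsionOf_iff x r).2 (Module.mem_annihilator.1 (h hr) x)
      exact hI.of_surjective ((Ideal.quotTorsionOfEquivSpanSingleton R M x).toLinearMap ∘ₗ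
        Submodule.factor hle) ((Ideal.quotTorsionOfEquivSpanSingleton R M x).surjective.comp
          (Submodule.factor_surjective hle))
    | sup K₁ K₂ hK₁ hK₂ h₁ h₂ =>
      have := hfp _ (hK₁.sup hK₂)
      refine (h₁.prod h₂).of_surjective ((Submodule.inclusion le_sup_left).coprod
        (Submodule.inclusion le_sup_right)) ?_
      rintro ⟨x, hx⟩
      obtain ⟨y, hy, z, hz, rfl⟩ := Submodule.mem_sup.1 hx
      exact ⟨(⟨y, hy⟩, ⟨z, hz⟩), rfl⟩
  exact (key ⊤ Module.Finite.fg_top).of_surjective Submodule.topEquiv.toLinearMap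
    Submodule.topEquiv.surjective

lemma fg_of_mem {I : Ideal R} (hI : Mem S (R ⧸ I)) : I.FG := by
  have := hI.1
  rw [← Submodule.ker_mkQ I]
  exact Module.FinitePresentation.fg_ker (Submodule.mkQ I) (Submodule.mkQ_surjective I)

lemma Mem.mono {I J : Ideal R} (hI : Mem S (R ⧸ I)) (hJ : J.FG) (h : I ≤ J) : Mem S (R ⧸ J) :=
  have := hJ.finitePresentation_quotient
  hI.of_surjective (Submodule.factor h) (Submodule.factor_surjective h)

/-- `R ⧸ I * J` is an extension of `R ⧸ I` by a module annihilated by `J`. -/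
lemma Mem.mul {I J : Ideal R} (hI : Mem S (R ⧸ I)) (hJ : Mem S (R ⧸ J)) :
    Mem S (R ⧸ I * J) := by
  have := (Ideal.FG.mul (fg_of_mem hI) (fg_of_mem hJ)).finitePresentation_quotient
  let K : Submodule R (R ⧸ I * J) := Submodule.map (I * J).mkQ I
  have hK : Module.FinitePresentation R K :=
    IsCoherentCommRing.fgSubmodulesFP_of_finitePresentation _ _ K.subtype
      K.injective_subtype (Module.Finite.iff_fg.2 (Submodule.FG.map _ (fg_of_mem hI)))
  have hJK : J ≤ Module.annihilator R K := by
    intro r hr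
    rw [Module.mem_annihilator]
    rintro ⟨_, y, hy, rfl⟩
    refine Subtype.ext ?_
    change (I * J).mkQ (r * y) = 0
    rw [← LinearMap.mem_ker, Submodule.ker_mkQ, mul_comm r y]
    exact Ideal.mul_mem_mul hy hr
  refine (hJ.of_le_annihilator hJK).of_exact hI K.subtype (Submodule.factor Ideal.mul_le_left)
    K.injective_subtype (Submodule.factor_surjective _) ?_
  rw [LinearMap.exact_iff, Submodule.range_subtype]
  ext x
  obtain ⟨x, rfl⟩ := (I * J).mkQ_surjective x
  constructor
  · intro hx
    exact ⟨x, Ideal.Quotient.eq_zero_iff_mem.1 hx, rfl⟩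
  · rintro ⟨y, hy, hxy⟩
    rw [← hxy]
    exact Ideal.Quotient.eq_zero_iff_mem.2 hy

/-- The ideals `I` with `R ⧸ I` in a given Serre subcategory. They determine the subcategory, see
`mem_iff`. -/
def ideals (S : SerreSubcategory (FPModuleCat R)) : Submonoid (Ideal R) where
  carrier := {I | Mem S (R ⧸ I)}
  mul_mem' := Mem.mul
  one_mem' := by
    have := S.2
    have hsub : Subsingleton (R ⧸ (1 : Ideal R)) := by
      rw [Ideal.one_eq_top]
      infer_instance
    obtain ⟨Z, hZ, hSZ⟩ := S.1.exists_prop_of_containsZero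
    exact (mem_obj_iff.2 hSZ).of_injective 0 (Function.injective_of_subsingleton _)

lemma mem_iff [Module.FinitePresentation R M] :
    Mem S M ↔ ∃ I ∈ ideals S, I ≤ Module.annihilator R M := by
  refine ⟨fun hM ↦ ?_, fun ⟨I, hI, h⟩ ↦ Mem.of_le_annihilator hI h⟩
  have key : ∀ K : Submodule R M, K.FG → ∃ I ∈ ideals S, I ≤ K.annihilator := by
    intro K hK
    induction K, hK using Submodule.fg_induction with
    | singleton x =>
      let e := Ideal.quotTorsionOfEquivSpanSingleton R M x
      refine ⟨Ideal.torsionOf R M x, hM.of_injective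
        ((Submodule.span R {x}).subtype ∘ₗ e.toLinearMap)
        ((Submodule.injective_subtype _).comp e.injective), fun r hr ↦ ?_⟩
      rw [Submodule.mem_annihilator_span_singleton]
      exact hr
    | sup K₁ K₂ _ _ h₁ h₂ =>
      obtain ⟨I, hI, hI'⟩ := h₁
      obtain ⟨J, hJ, hJ'⟩ := h₂
      refine ⟨I * J, mul_mem hI hJ, ?_⟩
      rw [Submodule.annihilator_sup]
      exact Ideal.mul_le_inf.trans (inf_le_inf hI' hJ')
  obtain ⟨I, hI, hI'⟩ := key ⊤ Module.Finite.fg_top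
  exact ⟨I, hI, by rwa [Submodule.annihilator_top] at hI'⟩

/-- The Serre subcategory of the finitely presented modules annihilated by some ideal of the
submonoid `F`. Products of ideals are what closure under extensions uses. -/
def annihilatedBy (F : Submonoid (Ideal R)) : SerreSubcategory (FPModuleCat R) where
  val A := ∃ I ∈ F, I ≤ Module.annihilator R A.obj
  property :=
    { exists_zero := by
        obtain ⟨Z, hZ⟩ := HasZeroObject.zero (C := FPModuleCat R)
        refine ⟨Z, hZ, 1, F.one_mem, fun r _ ↦ Module.mem_annihilator.2 fun x ↦ ?_⟩
        -- Every morphism to a zero object vanishes, in particular the identity.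
        have h (y : Z.obj) : y = 0 := congrArg (fun g ↦ g.hom.hom y) (hZ.eq_of_src (𝟙 Z) 0)
        exact h _
      prop_of_mono := fun f _ ⟨I, hI, h⟩ ↦
        ⟨I, hI, h.trans (f.hom.hom.annihilator_le_of_injective (injective_of_mono f))⟩
      prop_of_epi := fun f _ ⟨I, hI, h⟩ ↦
        ⟨I, hI, h.trans (f.hom.hom.annihilator_le_of_surjective (surjective_of_epi f))⟩
      prop_X₂_of_shortExact := by
        rintro T hT ⟨I, hI, hI'⟩ ⟨J, hJ, hJ'⟩
        refine ⟨I * J, F.mul_mem hI hJ, Ideal.mul_le.2 fun r hr s hs ↦ ?_⟩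
        rw [Module.mem_annihilator]
        intro x
        obtain ⟨y, hy⟩ := exact_of_shortExact hT (x := s • x) (by
          rw [map_smul, Module.mem_annihilator.1 (hJ' hs)])
        rw [mul_smul, ← hy, ← map_smul, Module.mem_annihilator.1 (hI' hr), map_zero] }

lemma annihilatedBy_apply {F : Submonoid (Ideal R)} {A : FPModuleCat R} :
    (annihilatedBy F).1 A ↔ ∃ I ∈ F, I ≤ Module.annihilator R A.obj := Iff.rfl

lemma apply_iff {A : FPModuleCat R} :
    S.1 A ↔ ∃ I ∈ ideals S, I ≤ Module.annihilator R A.obj :=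
  mem_obj_iff.symm.trans mem_iff

lemma mem_ideals_annihilatedBy {F : Submonoid (Ideal R)} {I : Ideal R} (hI : I.FG) :
    I ∈ ideals (annihilatedBy F) ↔ ∃ J ∈ F, J ≤ I := by
  have := hI.finitePresentation_quotient
  have h : I ∈ ideals (annihilatedBy F) ↔ (annihilatedBy F).1 (of R (R ⧸ I)) :=
    mem_obj_iff (A := of R (R ⧸ I))
  rw [h, annihilatedBy_apply]
  simp only [Ideal.annihilator_quotient]

lemma bot_notMem_ideals (hS : ¬ IsMax S) : (⊥ : Ideal R) ∉ ideals S := fun h ↦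
  hS fun _ _ _ _ ↦ apply_iff.2 ⟨⊥, h, bot_le⟩

/-! ### Irreducible Serre subcategories and prime ideals -/

/-- If `S` is irreducible and contains `R ⧸ (I + J)`, then it contains `R ⧸ I` or `R ⧸ J`: it is the
intersection of the Serre subcategories obtained by adjoining `R ⧸ I` and `R ⧸ J` to it, because
`(I + J) ^ (n + m) ≤ I ^ n + J ^ m`. -/
lemma mem_or_mem_of_sup_mem_ideals (hS : InfIrred S) {I J : Ideal R} (hI : I.FG) (hJ : J.FG)
    (h : I ⊔ J ∈ ideals S) : I ∈ ideals S ∨ J ∈ ideals S := by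
  have adjoin_mem : ∀ {K : Ideal R}, K.FG →
      annihilatedBy (ideals S ⊔ Submonoid.powers K) = S → K ∈ ideals S := fun {K} hK h ↦ by
    rw [← h, mem_ideals_annihilatedBy hK]
    exact ⟨K, Submonoid.mem_sup_right (Submonoid.mem_powers K), le_rfl⟩
  obtain ⟨-, hmeet⟩ := hS
  refine (@hmeet (annihilatedBy (ideals S ⊔ Submonoid.powers I))
    (annihilatedBy (ideals S ⊔ Submonoid.powers J)) ?_).imp (adjoin_mem hI) (adjoin_mem hJ)
  apply le_antisymm
  · rintro A ⟨⟨K₁, hK₁, hA₁⟩, ⟨K₂, hK₂, hA₂⟩⟩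
    obtain ⟨L₁, hL₁, _, ⟨n, rfl⟩, rfl⟩ := Submonoid.mem_sup.1 hK₁
    obtain ⟨L₂, hL₂, _, ⟨m, rfl⟩, rfl⟩ := Submonoid.mem_sup.1 hK₂
    refine apply_iff.2 ⟨L₁ * L₂ * (I ⊔ J) ^ (n + m), mul_mem (mul_mem hL₁ hL₂) (pow_mem h _), ?_⟩
    refine (Ideal.mul_mono_right Ideal.sup_pow_add_le_pow_sup_pow).trans ?_
    rw [Ideal.mul_sup]
    refine sup_le (le_trans ?_ hA₁) (le_trans ?_ hA₂)
    · exact Ideal.mul_mono_left Ideal.mul_le_left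
    · exact Ideal.mul_mono_left Ideal.mul_le_right
  · refine le_inf ?_ ?_ <;>
    · intro A hA
      obtain ⟨K, hK, hKA⟩ := apply_iff.1 hA
      exact ⟨K, Submonoid.mem_sup_left hK, hKA⟩

lemma exists_span_singleton_mem_ideals (hS : InfIrred S) {I : Ideal R} (hI : I ∈ ideals S) :
    ∃ r ∈ I, Ideal.span {r} ∈ ideals S := by
  have hfg := fg_of_mem hI
  induction I, hfg using Submodule.fg_induction with
  | singleton x => exact ⟨x, Submodule.mem_span_singleton_self x, hI⟩
  | sup I J hIfg hJfg h₁ h₂ =>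
    rcases mem_or_mem_of_sup_mem_ideals hS hIfg hJfg hI with h | h
    · obtain ⟨r, hr, hr'⟩ := h₁ h
      exact ⟨r, Submodule.mem_sup_left hr, hr'⟩
    · obtain ⟨r, hr, hr'⟩ := h₂ h
      exact ⟨r, Submodule.mem_sup_right hr, hr'⟩

/-- The prime ideal attached to an irreducible Serre subcategory `S`: it consists of the `r` with
`R ⧸ (r)` not in `S`. -/
def primeOfInfIrred (hS : InfIrred S) : PrimeSpectrum R where
  asIdeal :=
    { carrier := {r | Ideal.span {r} ∉ ideals S}
      zero_mem' := by
        simpa [Ideal.span_zero] using bot_notMem_ideals hS.1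
      add_mem' := by
        intro r s hr hs h
        have hle : Ideal.span {r + s} ≤ Ideal.span {r} ⊔ Ideal.span {s} := by
          rw [Ideal.span_singleton_le_iff_mem]
          exact add_mem (Submodule.mem_sup_left (Ideal.mem_span_singleton_self r))
            (Submodule.mem_sup_right (Ideal.mem_span_singleton_self s))
        have hrfg : (Ideal.span {r}).FG := Submodule.fg_span_singleton r
        have hsfg : (Ideal.span {s}).FG := Submodule.fg_span_singleton s
        exact (mem_or_mem_of_sup_mem_ideals hS hrfg hsfg (h.mono (Submodule.FG.sup hrfg hsfg) hle)).elim hr hs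
      smul_mem' := fun r s hs h ↦ hs (h.mono (Submodule.fg_span_singleton s)
        (Ideal.span_singleton_le_span_singleton.2 (dvd_mul_left s r))) }
  isPrime :=
    { ne_top' := by
        rw [Ideal.ne_top_iff_one]
        intro h
        refine h ?_
        rw [Ideal.span_singleton_one, ← Ideal.one_eq_top]
        exact one_mem _
      mem_or_mem' := by
        intro r s hrs
        by_contra! h
        refine hrs ?_
        rw [← Ideal.span_singleton_mul_span_singleton]
        exact mul_mem (not_not.1 h.1) (not_not.1 h.2) }

lemma mem_primeOfInfIrred (hS : InfIrred S) {r : R} :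
    r ∈ (primeOfInfIrred hS).asIdeal ↔ Ideal.span {r} ∉ ideals S := Iff.rfl

/-- The finitely presented modules annihilated by some ideal not contained in `P`, that is, the
finitely presented modules `A` with `A_P = 0`. -/
def ofPrime (P : PrimeSpectrum R) : SerreSubcategory (FPModuleCat R) :=
  annihilatedBy
    { carrier := {I | ¬ I ≤ P.asIdeal}
      mul_mem' := fun hI hJ h ↦ (P.isPrime.mul_le.1 h).elim hI hJ
      one_mem' := by
        simpa [Ideal.one_eq_top, top_le_iff] using P.isPrime.ne_top }

lemma ofPrime_apply {P : PrimeSpectrum R} {A : FPModuleCat R} :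
    (ofPrime P).1 A ↔ ∃ I : Ideal R, ¬ I ≤ P.asIdeal ∧ I ≤ Module.annihilator R A.obj := Iff.rfl

lemma mem_ideals_ofPrime {P : PrimeSpectrum R} {I : Ideal R} (hI : I.FG) :
    I ∈ ideals (ofPrime P) ↔ ¬ I ≤ P.asIdeal :=
  (mem_ideals_annihilatedBy hI).trans
    ⟨fun ⟨_, hJ, hJI⟩ h ↦ hJ (hJI.trans h), fun h ↦ ⟨I, h, le_rfl⟩⟩

lemma not_isMax_ofPrime (P : PrimeSpectrum R) : ¬ IsMax (ofPrime P) := by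
  intro h
  have htop : (⊤ : ObjectProperty (FPModuleCat R)).IsSerreClass := inferInstance
  obtain ⟨I, hI, hI'⟩ := ofPrime_apply.1
    (h (b := ⟨⊤, htop⟩) (show (ofPrime P).1 ≤ ⊤ from le_top) (of R R) trivial)
  refine hI fun r hr ↦ ?_
  have : r • (1 : R) = 0 := Module.mem_annihilator.1 (hI' hr) _
  rw [smul_eq_mul, mul_one] at this
  simp [this]

/-- If two Serre subcategories are not contained in that of `P`, they contain `R ⧸ I` and `R ⧸ J`
with `I, J ≤ P`; then their intersection contains `R ⧸ (I + J)`, which that of `P` does not. -/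
lemma infIrred_ofPrime (P : PrimeSpectrum R) : InfIrred (ofPrime P) := by
  refine ⟨not_isMax_ofPrime P, fun S T hST ↦ ?_⟩
  have exists_ideal : ∀ {U : SerreSubcategory (FPModuleCat R)}, ofPrime P ≤ U → U ≠ ofPrime P →
      ∃ I ∈ ideals U, I ≤ P.asIdeal := by
    intro U hU hne
    by_contra! hcon
    refine hne (le_antisymm (fun A hA ↦ ?_) hU)
    obtain ⟨I, hI, hIA⟩ := apply_iff.1 hA
    exact ⟨I, hcon I hI, hIA⟩
  by_contra! hne
  obtain ⟨I, hI, hIP⟩ := exists_ideal (hST ▸ inf_le_left) hne.1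
  obtain ⟨J, hJ, hJP⟩ := exists_ideal (hST ▸ inf_le_right) hne.2
  have hfg := Submodule.FG.sup (fg_of_mem hI) (fg_of_mem hJ)
  have hmem : I ⊔ J ∈ ideals (S ⊓ T) :=
    ⟨(hI.mono hfg le_sup_left).1, (hI.mono hfg le_sup_left).2, (hJ.mono hfg le_sup_right).2⟩
  rw [hST, mem_ideals_ofPrime hfg] at hmem
  exact hmem (sup_le hIP hJP)

lemma ofPrime_injective : Function.Injective (ofPrime (R := R)) := by
  intro P Q h
  ext r
  have hfg : (Ideal.span {r}).FG := Submodule.fg_span_singleton r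
  have hP := mem_ideals_ofPrime (P := P) hfg
  have hQ := mem_ideals_ofPrime (P := Q) hfg
  rw [h, hQ, not_iff_not] at hP
  simpa using hP.symm

lemma ofPrime_primeOfInfIrred (hS : InfIrred S) : ofPrime (primeOfInfIrred hS) = S := by
  apply le_antisymm
  · rintro A ⟨I, hI, hIA⟩
    obtain ⟨r, hrI, hr⟩ := Set.not_subset.1 hI
    refine apply_iff.2 ⟨Ideal.span {r}, not_not.1 ((mem_primeOfInfIrred hS).not.1 hr), ?_⟩
    exact (Ideal.span_singleton_le_iff_mem I).2 hrI |>.trans hIA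
  · intro A hA
    obtain ⟨I, hI, hIA⟩ := apply_iff.1 hA
    obtain ⟨r, hrI, hr⟩ := exists_span_singleton_mem_ideals hS hI
    exact ⟨I, fun h ↦ (mem_primeOfInfIrred hS).1 (h hrI) hr, hIA⟩

end SerreSubcategory

theorem corollary6p5 (R : Type u) [CommRing R] [IsCoherentCommRing R] :
    ∃ e : PrimeSpectrum R ≃ irreducibleSerre (FPModuleCat R),
      ∀ P : PrimeSpectrum R,
        (∃ (E : ModuleCat.{u} R) (ι : (R ⧸ P.asIdeal) →ₗ[R] E), IsInjectiveHull ι) ∧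
        ∀ (E : ModuleCat.{u} R) (ι : (R ⧸ P.asIdeal) →ₗ[R] E), IsInjectiveHull ι →
          ∀ A : FPModuleCat R, (e P).1.1 A ↔ ∀ f : A.obj →ₗ[R] E, f = 0 := by
  refine ⟨Equiv.ofBijective (fun P ↦ ⟨SerreSubcategory.ofPrime P,
      SerreSubcategory.infIrred_ofPrime P⟩) ⟨fun P Q h ↦ ?_, fun S ↦ ?_⟩, fun P ↦ ⟨?_, ?_⟩⟩
  · exact SerreSubcategory.ofPrime_injective (congrArg Subtype.val h)
  · exact ⟨_, Subtype.ext (SerreSubcategory.ofPrime_primeOfInfIrred S.2)⟩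
  · exact IsInjectiveHull.exists_isInjectiveHull _
  · exact fun E ι hι A ↦ hι.forall_hom_eq_zero_iff A.obj
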